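/- Let $E$ be a finite set of $n$ agents and let $(E,f)$ be a polymatroid, i.e. $f:2^E\to\mathbb R_{\ge 0}$ satisfies $f(\emptyset)=0$, is monotone, and $f(A)+f(B)\ge f(A\cup B)+f(A\cap B)$ for all $A,B\subseteq E$. Let $\mathcal P(f)=\{x\in\mathbb R_{\ge 0}^E : \sum_{i\in A}x_i\le f(A)\ \forall A\subseteq E\}$ and $\mathcal B(f)=\{x\in\mathcal P(f):\sum_{i\in E}x_i=f(E)\}$. The values $v_i$ of the agents are drawn independently from distributions $D_i$ supported on a common finite set of positive reals. A full-revelation signaling policy $\Omega$ sends the realized value of each agent to the receiver; it is specified by a probability distribution over selection rules, where a selection rule assigns to each vector $v$ of revealed values an allocation $x(v)\in\mathcal P(f)$, which for every $v$ of positive probability maximizes the welfare $\sum_{i\in E} v_i x_i$ over $\mathcal P(f)$. The expected utility of agent $i$ is $U_i(\Omega)=\mathbb E[v_i\,x_i(v)]$, the expectation being over $v$ and over the random choice of the selection rule. Let $\mathcal U=\{(U_i(\Omega))_{i\in E}\}$ be the set of expected utility vectors of all full-revelation signaling policies. For $S\subseteq E$ and a vector $v$ of possible values let $$g(S;v)=\max\Big\{\sum_{i\in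 S}v_ix_i : x\in\mathcal P(f)\text{ maximizes }\sum_{i\in E}v_ix_i\text{ over }\mathcal P(f)\Big\}.$$ Then $\mathcal U$ has a $1$-majorized point: there is $u\in\mathcal U$ such that, for every $k\in\{1,\dots,n\}$ and every $w\in\mathcal U$, the sum of the $k$ smallest coordinates of $u$ is at least the sum of the $k$ smallest coordinates of $w$. Moreover, these maxima $g(S;v)$ exist, $S\mapsto\mathbb E_v[g(S;v)]$ is non-negative, monotone, submodular and vanishes on $\emptyset$, i.e. it is the rank function of a polymatroid on $E$, and $\mathcal U$ is the base polytope $\mathcal B\big(\mathbb E_v[g(\cdot\,;v)]\big)$ of this polymatroid. -/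

import Mathlib

open Finset MeasureTheory

noncomputable section

namespace Persuasion

/-- `f` is the rank function of a polymatroid on the finite ground set `E`: a non-negative,
monotone, submodular set function that vanishes on the empty set. -/
structure IsPolymatroidRank {E : Type*} [DecidableEq E] (f : Finset E → ℝ) : Prop where
  empty : f ∅ = 0
  nonneg : ∀ A, 0 ≤ f A
  mono : ∀ A B, A ⊆ B → f A ≤ f B
  submodular : ∀ A B, f (A ∪ B) + f (A ∩ B) ≤ f A + f B

/-- The independence polytope `P(f)`: non-negative vectors `x` with `x(A) ≤ f(A)` for all `A`. -/
def indepPolytope {E : Type*} (f : Finset E → ℝ) : Set (E → ℝ) :=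
  {x | (∀ i, 0 ≤ x i) ∧ ∀ A : Finset E, ∑ i ∈ A, x i ≤ f A}

/-- The base polytope `B(f)`: the `x` in `P(f)` with `x(E) = f(E)`. -/
def basePolytope {E : Type*} [Fintype E] (f : Finset E → ℝ) : Set (E → ℝ) :=
  {x | x ∈ indepPolytope f ∧ ∑ i, x i = f univ}

/-- The allocations in `P(f)` that maximize the welfare `∑ i, μ i * x i`. -/
def welfareOptimal {E : Type*} [Fintype E] (f : Finset E → ℝ) (μ : E → ℝ) : Set (E → ℝ) :=
  {x | x ∈ indepPolytope f ∧ ∀ y ∈ indepPolytope f, ∑ i, μ i * y i ≤ ∑ i, μ i * x i}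

/-- The total utilities that the agents in `S` can get, for the value vector `v`, in a
welfare-optimal allocation. -/
def groupUtilities {E : Type*} [Fintype E] (f : Finset E → ℝ) (v : E → ℝ) (S : Finset E) :
    Set ℝ :=
  (fun x : E → ℝ => ∑ i ∈ S, v i * x i) '' welfareOptimal f v

/-- `g(S; v)`: the largest total utility of the agents in `S` over all welfare-optimal allocations
for the value vector `v`. -/
def saturation {E : Type*} [Fintype E] (f : Finset E → ℝ) (v : E → ℝ) (S : Finset E) : ℝ :=
  sSup (groupUtilities f v S)

/-- The expectation of `g(S; v)` when the values `v i` are drawn independently from the `D i`. -/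
def expectedSaturation {E : Type*} [Fintype E] [DecidableEq E] (f : Finset E → ℝ)
    {vals : Finset ℝ} (D : E → PMF vals) (S : Finset E) : ℝ :=
  ∑ a : E → vals, (∏ i, (D i (a i)).toReal) * saturation f (fun i => (a i : ℝ)) S

/-- A mapping rule: a finite set of signals for each agent, and for each possible value of the
agent a distribution over that agent's signals. Signals of different agents are drawn
independently. -/
structure MappingRule (E : Type*) (vals : Finset ℝ) where
  Signal : E → Type
  fintypeSignal : ∀ i, Fintype (Signal i)
  send : ∀ i, vals → PMF (Signal i)

instance {E : Type*} {vals : Finset ℝ} (M : MappingRule E vals) (i : E) :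
    Fintype (M.Signal i) := M.fintypeSignal i

/-- The full-revelation mapping rule: the signal of an agent is its realized value. -/
abbrev fullRevelation (E : Type*) (vals : Finset ℝ) : MappingRule E vals where
  Signal := fun _ => vals
  fintypeSignal := fun _ => inferInstance
  send := fun _ a => PMF.pure a

/-- The probability that agent `i` sends the signal `s`. -/
def signalProb {E : Type*} {vals : Finset ℝ} (D : E → PMF vals) (M : MappingRule E vals)
    (i : E) (s : M.Signal i) : ℝ :=
  ∑ a : vals, (D i a).toReal * (M.send i a s).toReal

/-- The probability of the signal profile `σ` (values and signals are independent across
agents). -/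
def profileProb {E : Type*} [Fintype E] {vals : Finset ℝ} (D : E → PMF vals)
    (M : MappingRule E vals) (σ : ∀ i, M.Signal i) : ℝ :=
  ∏ i, signalProb D M i (σ i)

/-- The posterior mean of the value of agent `i` after the signal `s`, by Bayes' rule
(meaningful when `s` has positive probability). -/
def posteriorMean {E : Type*} {vals : Finset ℝ} (D : E → PMF vals) (M : MappingRule E vals)
    (i : E) (s : M.Signal i) : ℝ :=
  (∑ a : vals, (D i a).toReal * (M.send i a s).toReal * (a : ℝ)) / signalProb D M i s

/-- `x` is a selection rule: it assigns a feasible allocation to each signal profile, and a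
welfare-optimal one (for the posterior means) to each profile of positive probability. -/
def IsSelectionRule {E : Type*} [Fintype E] (f : Finset E → ℝ) {vals : Finset ℝ}
    (D : E → PMF vals) (M : MappingRule E vals) (x : (∀ i, M.Signal i) → E → ℝ) : Prop :=
  ∀ σ, x σ ∈ indepPolytope f ∧
    (0 < profileProb D M σ → x σ ∈ welfareOptimal f (fun i => posteriorMean D M i (σ i)))

/-- A signaling policy all of whose realizations use the mapping rule `M`: a probability
distribution over selection rules. -/
structure Policy {E : Type*} [Fintype E] (f : Finset E → ℝ) {vals : Finset ℝ}
    (D : E → PMF vals) (M : MappingRule E vals) where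
  law : Measure ((∀ i, M.Signal i) → E → ℝ)
  isProbability : IsProbabilityMeasure law
  isSelectionRule : ∀ᵐ x ∂law, IsSelectionRule f D M x

/-- The expected utility of agent `i`; given a signal profile `σ`, its utility is its posterior
mean times its allocation. -/
def Policy.utility {E : Type*} [Fintype E] [DecidableEq E] {f : Finset E → ℝ} {vals : Finset ℝ}
    {D : E → PMF vals} {M : MappingRule E vals} (Ω : Policy f D M) (i : E) : ℝ :=
  ∫ x, ∑ σ : (∀ j, M.Signal j), profileProb D M σ * (posteriorMean D M i (σ i) * x σ i) ∂Ω.law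

/-- The set of expected utility vectors of the full-revelation signaling policies. -/
def fullRevelationUtilities {E : Type*} [Fintype E] [DecidableEq E] (f : Finset E → ℝ)
    {vals : Finset ℝ} (D : E → PMF vals) : Set (E → ℝ) :=
  Set.range fun Ω : Policy f D (fullRevelation E vals) => Ω.utility

/-- The sum of the `k` smallest coordinates of `u`. -/
def sumSmallest {E : Type*} [Fintype E] (k : ℕ) (u : E → ℝ) : ℝ :=
  (((univ.val.map u).sort (· ≤ ·)).take k).sum

/-- `u` is an `α`-majorized point of the set `U`: it lies in `U`, and for each `k` the sum of its
`k` smallest coordinates is at least `1 / α` times that of any other point of `U`. -/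
def IsMajorized {E : Type*} [Fintype E] (α : ℝ) (U : Set (E → ℝ)) (u : E → ℝ) : Prop :=
  u ∈ U ∧ ∀ k : ℕ, 1 ≤ k → k ≤ Fintype.card E → ∀ w ∈ U,
    1 / α * sumSmallest k w ≤ sumSmallest k u

end Persuasion

end

/-!
Serving the agents greedily in decreasing order of a weight gives an allocation that attains the
rank `f` on every upper level set of the weight; summation by parts over these level sets shows that
it is optimal, and that every optimal allocation attains `f` on all of them. For the values `v` as
weights, this says that the level sets of `v` can be filled independently of each other, the level
set of value `t` by an arbitrary base of the marginal rank `levelGain f v t`. The utility vectors of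
the optimal allocations thus form the base polytope of `∑ t, t * levelGain f v t`, which is
therefore the function `g(·; v)`.

Full revelation averages these polytopes over `v`. A Minkowski combination of base polytopes is the
base polytope of the combined rank functions: it is convex and compact, and since one greedy order
serves all summands at once it attains the support function of the larger polytope in every
direction, so Hahn–Banach leaves no point outside.

The point `u` of least Euclidean norm of a base polytope maximizes `-u`, so it attains the rank on
each set `{i | u i ≤ c}` and minimizes every `∑ i, (c - u i)⁺`. This makes it majorized, because the
sum of the `k` smallest coordinates is the maximum over `c` of `k * c - ∑ i, (c - u i)⁺`.
-/

noncomputable section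

namespace Persuasion

/-! ### Summation along level sets -/

section Levels

variable {ι R : Type*} [LinearOrder R]

lemma exists_pos_gaps [AddCommGroup R] [IsOrderedAddMonoid R] (T : Finset R) {c : R}
    (hc : ∀ t ∈ T, c < t) :
    ∃ g : R → R, (∀ t ∈ T, 0 < g t) ∧ ∀ s ∈ T, ∑ t ∈ T with t ≤ s, g t = s - c := by
  induction T using Finset.induction_on_min generalizing c with
  | empty => exact ⟨0, by simp, by simp⟩
  | insert a T ha ih =>
    obtain ⟨g, hg_pos, hg_sum⟩ := ih ha
    have haT : a ∉ T := fun h => lt_irrefl a (ha a h)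
    have hsum : ∀ s, a ≤ s → ∑ t ∈ insert a T with t ≤ s, Function.update g a (a - c) t =
        a - c + ∑ t ∈ T with t ≤ s, g t := fun s has => by
      have haTs : a ∉ T.filter (· ≤ s) := fun h => haT (mem_filter.1 h).1
      rw [filter_insert, if_pos has, sum_insert haTs, Function.update_self,
        sum_update_of_notMem haTs]
    refine ⟨Function.update g a (a - c), (forall_mem_insert _ _ _).2 ⟨?_, fun t ht => ?_⟩,
      (forall_mem_insert _ _ _).2 ⟨?_, fun s hs => ?_⟩⟩
    · simpa using hc a (mem_insert_self a T)
    · rw [Function.update_of_ne (ha t ht).ne']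
      exact hg_pos t ht
    · rw [hsum a le_rfl, filter_false_of_mem fun t ht => (ha t ht).not_ge, sum_empty, add_zero]
    · rw [hsum s (ha s hs).le, hg_sum s hs]
      abel

lemma sum_levels_telescope {G : Type*} [AddCommGroup G] (h : Finset ι → G) (v : ι → R)
    (S : Finset ι) :
    ∑ t ∈ S.image v, (h {i ∈ S | t ≤ v i} - h {i ∈ S | t < v i}) = h S - h ∅ := by
  induction S using Finset.strongInduction with
  | H S ih =>
    obtain rfl | hS := S.eq_empty_or_nonempty
    · simp
    obtain ⟨j, hj, hmin⟩ := exists_min_image S v hS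
    set S' := {i ∈ S | v j < v i} with hS'
    have himage : S.image v = insert (v j) (S'.image v) := by
      ext t
      simp only [hS', mem_image, mem_insert, mem_filter]
      constructor
      · rintro ⟨i, hi, rfl⟩
        exact (hmin i hi).eq_or_lt.imp Eq.symm fun h => ⟨i, ⟨hi, h⟩, rfl⟩
      · rintro (rfl | ⟨i, hi, rfl⟩)
        exacts [⟨j, hj, rfl⟩, ⟨i, hi.1, rfl⟩]
    have hrest : ∀ t ∈ S'.image v, h {i ∈ S | t ≤ v i} - h {i ∈ S | t < v i} =
        h {i ∈ S' | t ≤ v i} - h {i ∈ S' | t < v i} := by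
      intro t ht
      obtain ⟨k, hk, rfl⟩ := mem_image.1 ht
      have hjk : v j < v k := (mem_filter.1 hk).2
      simp only [hS', filter_filter]
      congr 2 <;> refine filter_congr fun i _ => ?_
      · exact ⟨fun hi => ⟨hjk.trans_le hi, hi⟩, And.right⟩
      · exact ⟨fun hi => ⟨hjk.trans hi, hi⟩, And.right⟩
    rw [himage, sum_insert (by simp +contextual [hS', ne_of_gt]), sum_congr rfl hrest,
      ih S' (filter_ssubset.2 ⟨j, hj, lt_irrefl _⟩), filter_true_of_mem hmin,
      sub_add_sub_cancel]

lemma sum_fiber_sum {M : Type*} [AddCommMonoid M] (v : ι → R) (x : ι → M)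
    (S : Finset ι) : ∑ t ∈ S.image v, ∑ i ∈ S with v i = t, x i = ∑ i ∈ S, x i :=
  sum_fiberwise_of_maps_to (fun _ => mem_image_of_mem v) x

variable [Fintype ι]

lemma filter_eq_empty_or_exists_level {p : R → Prop} [DecidablePred p] (hp : Monotone p)
    (w : ι → R) :
    ({i | p (w i)} : Finset ι) = ∅ ∨
      ∃ j, ({i | p (w i)} : Finset ι) = ({i | w j ≤ w i} : Finset ι) := by
  refine (eq_empty_or_nonempty _).imp_right fun hne => ?_
  obtain ⟨j, hj, hmin⟩ := exists_min_image _ w hne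
  refine ⟨j, filter_congr fun i _ => ⟨fun hi => hmin i (by simpa using hi), fun hi => ?_⟩⟩
  exact hp hi (mem_filter.1 hj).2

lemma sum_mul_eq_sum_levels [NonUnitalNonAssocSemiring R] (v x : ι → R) (S : Finset ι) :
    ∑ i ∈ S, v i * x i = ∑ t ∈ univ.image v, t * ∑ i ∈ S with v i = t, x i := by
  rw [← sum_fiberwise_of_maps_to fun i _ => mem_image_of_mem v (mem_univ i)]
  refine sum_congr rfl fun t _ => ?_
  rw [mul_sum]
  exact sum_congr rfl fun i hi => by rw [(mem_filter.1 hi).2]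

variable [Ring R] [IsStrictOrderedRing R] {w : ι → R} {c : R}

/-- Here `g t` is the gap between `t` and the next smaller value of `w`, or `c` if there is
none. -/
lemma exists_layer_cake (hc : ∀ i, c < w i) :
    ∃ g : R → R, (∀ i, 0 < g (w i)) ∧ ∀ d : ι → R,
      ∑ i, (w i - c) * d i = ∑ t ∈ univ.image w, g t * ∑ i with t ≤ w i, d i := by
  obtain ⟨g, hg_pos, hg_sum⟩ := exists_pos_gaps (univ.image w) (c := c) (by simpa using hc)
  refine ⟨g, fun i => hg_pos _ (mem_image_of_mem w (mem_univ i)), fun d => ?_⟩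
  calc ∑ i, (w i - c) * d i = ∑ i, ∑ t ∈ univ.image w with t ≤ w i, g t * d i :=
        sum_congr rfl fun i _ => by rw [← hg_sum _ (mem_image_of_mem w (mem_univ i)), sum_mul]
    _ = ∑ t ∈ univ.image w, ∑ i with t ≤ w i, g t * d i :=
        sum_comm' fun i t => by simp [and_comm]
    _ = ∑ t ∈ univ.image w, g t * ∑ i with t ≤ w i, d i := by simp only [mul_sum]

lemma sum_sub_mul_nonneg_of_level_sums_nonneg {d : ι → R} (hc : ∀ i, c < w i)
    (hd : ∀ t, 0 ≤ ∑ i with t ≤ w i, d i) : 0 ≤ ∑ i, (w i - c) * d i := by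
  obtain ⟨g, hg, hcake⟩ := exists_layer_cake hc
  rw [hcake]
  refine sum_nonneg fun t ht => mul_nonneg ?_ (hd t)
  obtain ⟨i, -, rfl⟩ := mem_image.1 ht
  exact (hg i).le

lemma level_sum_eq_zero_of_sum_sub_mul_nonpos {d : ι → R} (hc : ∀ i, c < w i)
    (hd : ∀ t, 0 ≤ ∑ i with t ≤ w i, d i) (hle : ∑ i, (w i - c) * d i ≤ 0) (t : R) :
    ∑ i with t ≤ w i, d i = 0 := by
  obtain ⟨g, hg, hcake⟩ := exists_layer_cake hc
  have hterm_nonneg : ∀ t ∈ univ.image w, 0 ≤ g t * ∑ i with t ≤ w i, d i := fun t ht => by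
    obtain ⟨i, -, rfl⟩ := mem_image.1 ht
    exact mul_nonneg (hg i).le (hd _)
  have hterm_zero := (sum_eq_zero_iff_of_nonneg hterm_nonneg).1
    ((hcake d ▸ hle).antisymm (sum_nonneg hterm_nonneg))
  obtain h | ⟨j, h⟩ := filter_eq_empty_or_exists_level (p := (t ≤ ·))
    (fun a b hab hta => le_trans hta hab) w
  · rw [h, sum_empty]
  · rw [h]
    exact (mul_eq_zero.1 (hterm_zero _ (mem_image_of_mem w (mem_univ j)))).resolve_left (hg j).ne'

end Levels

/-! ### Base polytopes -/

section Polytopes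

variable {E : Type*} {f : Finset E → ℝ}

lemma convex_indepPolytope (f : Finset E → ℝ) : Convex ℝ (indepPolytope f) := by
  rintro x ⟨hx_nonneg, hx_le⟩ y ⟨hy_nonneg, hy_le⟩ a b ha hb hab
  refine ⟨fun i => add_nonneg (mul_nonneg ha (hx_nonneg i)) (mul_nonneg hb (hy_nonneg i)),
    fun A => ?_⟩
  calc ∑ i ∈ A, (a • x + b • y) i = a * ∑ i ∈ A, x i + b * ∑ i ∈ A, y i := by
        simp [sum_add_distrib, mul_sum]
    _ ≤ a * f A + b * f A := by gcongr <;> [exact hx_le A; exact hy_le A]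
    _ = f A := by rw [← add_mul, hab, one_mul]

lemma isCompact_indepPolytope (f : Finset E → ℝ) : IsCompact (indepPolytope f) := by
  have hclosed : IsClosed (indepPolytope f) := by
    simp only [indepPolytope, Set.ofPred_and, Set.ofPred_forall]
    exact (isClosed_iInter fun i => isClosed_le continuous_const (continuous_apply i)).inter
      (isClosed_iInter fun A => isClosed_le (by fun_prop) continuous_const)
  refine (isCompact_Icc (a := 0) (b := fun i => f {i})).of_isClosed_subset hclosed ?_
  exact fun x hx => ⟨hx.1, fun i => by simpa using hx.2 {i}⟩

variable [Fintype E]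

lemma convex_basePolytope (f : Finset E → ℝ) : Convex ℝ (basePolytope f) :=
  (convex_indepPolytope f).inter
    (convex_hyperplane (f := fun x : E → ℝ => ∑ i, x i)
      ⟨fun x y => by simp [sum_add_distrib], fun c x => by simp [mul_sum]⟩ (f univ))

lemma isCompact_basePolytope (f : Finset E → ℝ) : IsCompact (basePolytope f) :=
  (isCompact_indepPolytope f).inter_right (isClosed_eq (by fun_prop) continuous_const)

end Polytopes

section Tight

variable {E : Type*} [Fintype E] {f : Finset E → ℝ} {w x y : E → ℝ}

/-- The vector `x` attains `f` on every upper level set of the weight `w`. Among the vectors of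
`P(f)` this singles out the outcomes of the greedy algorithm that serves the agents in decreasing
order of `w`. -/
def TightOnLevels (f : Finset E → ℝ) (w x : E → ℝ) : Prop :=
  ∀ t, ∑ i with t ≤ w i, x i = f {i | t ≤ w i}

lemma TightOnLevels.sum_lt (hx : TightOnLevels f w x) (hf : f ∅ = 0) (t : ℝ) :
    ∑ i with t < w i, x i = f {i | t < w i} := by
  obtain h | ⟨j, h⟩ := filter_eq_empty_or_exists_level (p := (t < ·))
    (fun a b hab hta => lt_of_lt_of_le hta hab) w
  · rw [h, sum_empty, hf]
  · rw [h, hx]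

lemma exists_forall_lt {ι : Type*} [Finite ι] (w : ι → ℝ) : ∃ c, ∀ i, c < w i := by
  obtain ⟨c, hc⟩ := (Set.finite_range w).bddBelow
  exact ⟨c - 1, fun i => (sub_one_lt c).trans_le (hc ⟨i, rfl⟩)⟩

lemma TightOnLevels.sum_univ (hx : TightOnLevels f w x) : ∑ i, x i = f univ := by
  obtain ⟨c, hc⟩ := exists_forall_lt w
  simpa [filter_true_of_mem fun i _ => (hc i).le] using hx c

lemma TightOnLevels.level_sum_sub_nonneg (hy : TightOnLevels f w y) (hx : x ∈ indepPolytope f)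
    (t : ℝ) : 0 ≤ ∑ i with t ≤ w i, (y i - x i) := by
  rw [sum_sub_distrib, hy t]
  exact sub_nonneg.2 (hx.2 _)

lemma TightOnLevels.sum_sub_mul_le (hy : TightOnLevels f w y) (hx : x ∈ indepPolytope f) {c : ℝ}
    (hc : ∀ i, c < w i) : ∑ i, (w i - c) * x i ≤ ∑ i, (w i - c) * y i := by
  rw [← sub_nonneg, ← sum_sub_distrib]
  simpa only [mul_sub] using
    sum_sub_mul_nonneg_of_level_sums_nonneg hc (hy.level_sum_sub_nonneg hx)

lemma TightOnLevels.of_sum_sub_mul_le (hy : TightOnLevels f w y) (hx : x ∈ indepPolytope f) {c : ℝ}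
    (hc : ∀ i, c < w i) (hle : ∑ i, (w i - c) * y i ≤ ∑ i, (w i - c) * x i) :
    TightOnLevels f w x := by
  intro t
  have hzero := level_sum_eq_zero_of_sum_sub_mul_nonpos hc (hy.level_sum_sub_nonneg hx)
    (by simpa only [mul_sub, sum_sub_distrib, sub_nonpos] using hle) t
  rw [sum_sub_distrib, hy t] at hzero
  exact (sub_eq_zero.1 hzero).symm

lemma sum_sub_mul_of_mem_basePolytope (hx : x ∈ basePolytope f) (w : E → ℝ) (c : ℝ) :
    ∑ i, (w i - c) * x i = ∑ i, w i * x i - c * f univ := by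
  simp only [sub_mul, sum_sub_distrib, ← mul_sum, hx.2]

lemma TightOnLevels.sum_mul_le (hy : TightOnLevels f w y) (hx : x ∈ basePolytope f) :
    ∑ i, w i * x i ≤ ∑ i, w i * y i := by
  obtain ⟨c, hc⟩ := exists_forall_lt w
  have hle := hy.sum_sub_mul_le hx.1 hc
  simp only [sub_mul, sum_sub_distrib, ← mul_sum, hx.2, hy.sum_univ] at hle
  linarith

lemma TightOnLevels.sum_smul {ι : Type*} [Fintype ι] {p : ι → ℝ} {g : ι → Finset E → ℝ}
    {y : ι → E → ℝ} (hy : ∀ a, TightOnLevels (g a) w (y a)) :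
    TightOnLevels (fun S => ∑ a, p a * g a S) w (∑ a, p a • y a) := by
  intro t
  simp only [Finset.sum_apply, Pi.smul_apply, smul_eq_mul]
  rw [sum_comm]
  simp only [← mul_sum, hy _ t]

lemma basePolytope_subset_of_exists_tightOnLevels {K : Set (E → ℝ)} (hK : Convex ℝ K)
    (hK_closed : IsClosed K) (h : ∀ w, ∃ y ∈ K, TightOnLevels f w y) : basePolytope f ⊆ K := by
  classical
  intro z hz
  by_contra hzK
  obtain ⟨φ, r, hφ_lt, hφ_gt⟩ := geometric_hahn_banach_closed_point hK hK_closed hzK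
  let w : E → ℝ := fun i => φ fun j => if i = j then 1 else 0
  have hφ : ∀ x, φ x = ∑ i, w i * x i := fun x => by
    simpa [w, mul_comm] using LinearMap.pi_apply_eq_sum_univ φ.toLinearMap x
  obtain ⟨y, hyK, hy⟩ := h w
  have hle : φ z ≤ φ y := by
    rw [hφ, hφ]
    exact hy.sum_mul_le hz
  exact ((hφ_lt y hyK).trans hφ_gt).not_ge hle

end Tight

section Greedy

variable {E : Type*} [DecidableEq E] {f : Finset E → ℝ}

/-- `x` is a base of the restriction of `f` to the subsets of `A`; the coordinates of `x` outside
`A` are only required to be non-negative. -/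
structure IsBaseOn (f : Finset E → ℝ) (A : Finset E) (x : E → ℝ) : Prop where
  nonneg : ∀ i, 0 ≤ x i
  sum_le : ∀ B ⊆ A, ∑ i ∈ B, x i ≤ f B
  sum_eq : ∑ i ∈ A, x i = f A

lemma IsBaseOn.update_insert (hf : IsPolymatroidRank f) {A : Finset E} {x : E → ℝ}
    (hx : IsBaseOn f A x) {a : E} (ha : a ∉ A) :
    IsBaseOn f (insert a A) (Function.update x a (f (insert a A) - f A)) := by
  have hsum : ∀ B ⊆ A, ∑ i ∈ B, Function.update x a (f (insert a A) - f A) i = ∑ i ∈ B, x i :=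
    fun B hB => sum_update_of_notMem (fun h => ha (hB h)) _ _
  refine ⟨fun i => ?_, fun B hB => ?_, ?_⟩
  · obtain rfl | hi := eq_or_ne i a
    · rw [Function.update_self]
      exact sub_nonneg.2 (hf.mono _ _ (subset_insert _ _))
    · rw [Function.update_of_ne hi]
      exact hx.nonneg i
  · by_cases haB : a ∈ B
    · have herase : B.erase a ⊆ A := subset_insert_iff.1 hB
      have hunion : B ∪ A = insert a A := by grind
      have hinter : B ∩ A = B.erase a := by grind
      have hsub := hf.submodular B A
      rw [hunion, hinter] at hsub
      rw [← add_sum_erase B _ haB, hsum _ herase, Function.update_self]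
      linarith [hx.sum_le _ herase]
    · have hBA : B ⊆ A := (subset_insert_iff_of_notMem haB).1 hB
      rw [hsum B hBA]
      exact hx.sum_le B hBA
  · rw [sum_insert ha, hsum A subset_rfl, hx.sum_eq, Function.update_self, sub_add_cancel]

/-- The greedy algorithm adds the agents in decreasing order of `w`, giving each its marginal
rank. -/
lemma IsPolymatroidRank.exists_isBaseOn_tight (hf : IsPolymatroidRank f) (w : E → ℝ)
    (A : Finset E) :
    ∃ x, IsBaseOn f A x ∧ ∀ t, ∑ i ∈ A with t ≤ w i, x i = f {i ∈ A | t ≤ w i} := by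
  induction A using Finset.induction_on_min_value w with
  | empty => exact ⟨0, ⟨by simp, by simp [hf.empty], by simp [hf.empty]⟩, by simp [hf.empty]⟩
  | insert a A ha hmin ih =>
    obtain ⟨x, hx, hx_tight⟩ := ih
    have hbase := hx.update_insert hf ha
    refine ⟨_, hbase, fun t => ?_⟩
    by_cases ht : t ≤ w a
    · have hall : {i ∈ insert a A | t ≤ w i} = insert a A :=
        filter_true_of_mem ((forall_mem_insert _ _ _).2 ⟨ht, fun i hi => ht.trans (hmin i hi)⟩)
      rw [hall, hbase.sum_eq]
    · rw [filter_insert, if_neg ht, sum_update_of_notMem fun h => ha (mem_filter.1 h).1, hx_tight]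

variable [Fintype E]

lemma IsPolymatroidRank.exists_tightOnLevels (hf : IsPolymatroidRank f) (w : E → ℝ) :
    ∃ x ∈ basePolytope f, TightOnLevels f w x := by
  obtain ⟨x, hx, hx_tight⟩ := hf.exists_isBaseOn_tight w univ
  exact ⟨x, ⟨⟨hx.nonneg, fun A => hx.sum_le A (subset_univ A)⟩, hx.sum_eq⟩, hx_tight⟩

lemma IsPolymatroidRank.exists_mem_basePolytope_sum_eq (hf : IsPolymatroidRank f) (S : Finset E) :
    ∃ x ∈ basePolytope f, ∑ i ∈ S, x i = f S := by
  obtain ⟨x, hx, hx_tight⟩ := hf.exists_tightOnLevels fun i => if i ∈ S then 1 else 0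
  have hlevel : ({i | (1 : ℝ) ≤ if i ∈ S then 1 else 0} : Finset E) = S := by
    ext i
    by_cases hi : i ∈ S <;> simp [hi]
  exact ⟨x, hx, by simpa only [hlevel] using hx_tight 1⟩

lemma IsPolymatroidRank.tightOnLevels_of_isMaxOn (hf : IsPolymatroidRank f) {w x : E → ℝ}
    (hx : x ∈ basePolytope f) (hmax : ∀ y ∈ basePolytope f, ∑ i, w i * y i ≤ ∑ i, w i * x i) :
    TightOnLevels f w x := by
  obtain ⟨y, hy, hy_tight⟩ := hf.exists_tightOnLevels w
  obtain ⟨c, hc⟩ := exists_forall_lt w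
  refine hy_tight.of_sum_sub_mul_le hx.1 hc ?_
  rw [sum_sub_mul_of_mem_basePolytope hx, sum_sub_mul_of_mem_basePolytope hy]
  exact sub_le_sub_right (hmax y hy) _

end Greedy

/-! ### Conic combinations of polymatroids -/

section Conic

variable {E ι : Type*} {p : ι → ℝ} {g : ι → Finset E → ℝ}

lemma isPolymatroidRank_sum_mul [DecidableEq E] {T : Finset ι} (hp : ∀ a ∈ T, 0 ≤ p a)
    (hg : ∀ a ∈ T, IsPolymatroidRank (g a)) :
    IsPolymatroidRank fun S => ∑ a ∈ T, p a * g a S where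
  empty := sum_eq_zero fun a ha => by rw [(hg a ha).empty, mul_zero]
  nonneg A := sum_nonneg fun a ha => mul_nonneg (hp a ha) ((hg a ha).nonneg A)
  mono A B h := sum_le_sum fun a ha => mul_le_mul_of_nonneg_left ((hg a ha).mono A B h) (hp a ha)
  submodular A B := by
    simp only [← sum_add_distrib, ← mul_add]
    exact sum_le_sum fun a ha =>
      mul_le_mul_of_nonneg_left ((hg a ha).submodular A B) (hp a ha)

variable [Fintype E] [Fintype ι]

lemma sum_smul_mem_basePolytope (hp : ∀ a, 0 ≤ p a) {y : ι → E → ℝ}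
    (hy : ∀ a, 0 < p a → y a ∈ basePolytope (g a)) :
    ∑ a, p a • y a ∈ basePolytope fun S => ∑ a, p a * g a S := by
  have hsum : ∀ S : Finset E,
      ∑ i ∈ S, (∑ a, p a • y a) i = ∑ a, p a * ∑ i ∈ S, y a i := fun S => by
    simp only [Finset.sum_apply, Pi.smul_apply, smul_eq_mul, mul_sum]
    exact sum_comm
  refine ⟨⟨fun i => ?_, fun S => ?_⟩, ?_⟩
  · rw [Finset.sum_apply]
    refine sum_nonneg fun a _ => ?_
    obtain ha | ha := (hp a).eq_or_lt
    · simp [← ha]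
    · exact mul_nonneg ha.le ((hy a ha).1.1 i)
  · rw [hsum]
    refine sum_le_sum fun a _ => ?_
    obtain ha | ha := (hp a).eq_or_lt
    · simp [← ha]
    · exact mul_le_mul_of_nonneg_left ((hy a ha).1.2 S) ha.le
  · rw [hsum]
    refine sum_congr rfl fun a _ => ?_
    obtain ha | ha := (hp a).eq_or_lt
    · simp [← ha]
    · rw [(hy a ha).2]

lemma exists_sum_smul_eq_of_mem_basePolytope [DecidableEq E] (hg : ∀ a, IsPolymatroidRank (g a))
    {z : E → ℝ} (hz : z ∈ basePolytope fun S => ∑ a, p a * g a S) :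
    ∃ y : ι → E → ℝ, (∀ a, y a ∈ basePolytope (g a)) ∧ ∑ a, p a • y a = z := by
  let T : (ι → E → ℝ) →ₗ[ℝ] E → ℝ := ∑ a, p a • LinearMap.proj a
  let B : Set (ι → E → ℝ) := Set.univ.pi fun a => basePolytope (g a)
  have hT : ∀ y, T y = ∑ a, p a • y a := fun y => by simp [T]
  have hB_convex : Convex ℝ B := convex_pi fun a _ => convex_basePolytope (g a)
  have hB_compact : IsCompact B := isCompact_univ_pi fun a => isCompact_basePolytope (g a)
  have hsubset : basePolytope (fun S => ∑ a, p a * g a S) ⊆ T '' B := by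
    refine basePolytope_subset_of_exists_tightOnLevels (hB_convex.linear_image T)
      (hB_compact.image T.continuous_of_finiteDimensional).isClosed fun w => ?_
    choose y hy hy_tight using fun a => (hg a).exists_tightOnLevels w
    exact ⟨T y, ⟨y, fun a _ => hy a, rfl⟩, hT y ▸ TightOnLevels.sum_smul hy_tight⟩
  obtain ⟨y, hy, hyz⟩ := hsubset hz
  exact ⟨y, fun a => hy a trivial, by rw [← hT, hyz]⟩

end Conic

/-! ### Welfare-optimal allocations -/

section LevelGain

variable {E : Type*} [Fintype E] [DecidableEq E] {f : Finset E → ℝ} {v x : E → ℝ}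

/-- The marginal rank of the agents in `S` of value exactly `t` on top of all agents of value more
than `t`. In a welfare-optimal allocation these agents get at most this much together. -/
def levelGain (f : Finset E → ℝ) (v : E → ℝ) (t : ℝ) (S : Finset E) : ℝ :=
  f (({i | t < v i} : Finset E) ∪ {i ∈ S | v i = t}) - f {i | t < v i}

lemma isPolymatroidRank_levelGain (hf : IsPolymatroidRank f) (v : E → ℝ) (t : ℝ) :
    IsPolymatroidRank (levelGain f v t) where
  empty := by simp [levelGain]
  nonneg A := sub_nonneg.2 (hf.mono _ _ subset_union_left)
  mono A B h := sub_le_sub_right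
    (hf.mono _ _ (union_subset_union_right (filter_subset_filter _ h))) _
  submodular A B := by
    have hsub := hf.submodular (({i | t < v i} : Finset E) ∪ {i ∈ A | v i = t})
      (({i | t < v i} : Finset E) ∪ {i ∈ B | v i = t})
    rw [← union_union_distrib_left, ← filter_union, ← union_inter_distrib_left,
      ← filter_inter_distrib] at hsub
    simp only [levelGain]
    linarith

lemma levelGain_univ (f : Finset E → ℝ) (v : E → ℝ) (t : ℝ) :
    levelGain f v t univ = f {i | t ≤ v i} - f {i | t < v i} := by
  rw [levelGain, ← filter_or]
  simp only [le_iff_lt_or_eq, eq_comm]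

lemma levelGain_le (hf : IsPolymatroidRank f) (v : E → ℝ) (t : ℝ) (S : Finset E) :
    levelGain f v t S ≤ f {i ∈ S | t ≤ v i} - f {i ∈ S | t < v i} := by
  have hsub := hf.submodular {i | t < v i} {i ∈ S | t ≤ v i}
  have hunion : ({i | t < v i} : Finset E) ∪ {i ∈ S | t ≤ v i} =
      ({i | t < v i} : Finset E) ∪ {i ∈ S | v i = t} := by
    grind
  have hinter : ({i | t < v i} : Finset E) ∩ {i ∈ S | t ≤ v i} = {i ∈ S | t < v i} := by
    grind
  rw [hunion, hinter] at hsub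
  rw [levelGain]
  linarith

/-- On each level set of `v`, the vector `x` is a base of the corresponding `levelGain`. -/
structure IsLevelwiseBase (f : Finset E → ℝ) (v x : E → ℝ) : Prop where
  nonneg : ∀ i, 0 ≤ x i
  sum_le : ∀ j S, ∑ i ∈ S with v i = v j, x i ≤ levelGain f v (v j) S
  sum_eq : ∀ j, ∑ i with v i = v j, x i = levelGain f v (v j) univ

lemma TightOnLevels.isLevelwiseBase (hx_tight : TightOnLevels f v x) (hf : f ∅ = 0)
    (hx : x ∈ indepPolytope f) : IsLevelwiseBase f v x := by
  have hsum : ∀ t S, ∑ i ∈ S with v i = t, x i =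
      ∑ i ∈ ({i | t < v i} : Finset E) ∪ {i ∈ S | v i = t}, x i - f {i | t < v i} := fun t S => by
    rw [sum_union (by simp +contextual [disjoint_left, ne_of_gt]), hx_tight.sum_lt hf,
      add_sub_cancel_left]
  refine ⟨hx.1, fun j S => ?_, fun j => ?_⟩
  · rw [hsum]
    exact sub_le_sub_right (hx.2 _) _
  · rw [hsum, levelGain_univ, ← hx_tight, ← filter_or]
    simp only [le_iff_lt_or_eq, eq_comm]

lemma IsLevelwiseBase.mem_indepPolytope (hx : IsLevelwiseBase f v x) (hf : IsPolymatroidRank f) :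
    x ∈ indepPolytope f := by
  refine ⟨hx.nonneg, fun S => ?_⟩
  calc ∑ i ∈ S, x i = ∑ t ∈ S.image v, ∑ i ∈ S with v i = t, x i := (sum_fiber_sum v x S).symm
    _ ≤ ∑ t ∈ S.image v, (f {i ∈ S | t ≤ v i} - f {i ∈ S | t < v i}) :=
        sum_le_sum fun t ht => by
          obtain ⟨j, -, rfl⟩ := mem_image.1 ht
          exact (hx.sum_le j S).trans (levelGain_le hf v (v j) S)
    _ = f S := by rw [sum_levels_telescope, hf.empty, sub_zero]

end LevelGain

section LevelRank

variable {E : Type*} [Fintype E] [DecidableEq E] {f : Finset E → ℝ} {v x : E → ℝ}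

/-- The sum of the level gains weighted by the values: a closed form of `saturation`, from which its
polymatroid properties are read off. -/
def levelRank (f : Finset E → ℝ) (v : E → ℝ) (S : Finset E) : ℝ :=
  ∑ t ∈ univ.image v, t * levelGain f v t S

lemma isPolymatroidRank_levelRank (hf : IsPolymatroidRank f) (hv : ∀ i, 0 ≤ v i) :
    IsPolymatroidRank (levelRank f v) :=
  isPolymatroidRank_sum_mul (by simpa using hv) fun t _ => isPolymatroidRank_levelGain hf v t

lemma levelRank_level (f : Finset E → ℝ) (v : E → ℝ) (j : E) (S : Finset E) :
    levelRank f v {i ∈ S | v i = v j} = v j * levelGain f v (v j) S := by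
  rw [levelRank, sum_eq_single_of_mem (v j) (mem_image_of_mem v (mem_univ j)) fun t _ ht => ?_]
  · simp [levelGain, filter_filter]
  · have hempty : {i ∈ ({i ∈ S | v i = v j} : Finset E) | v i = t} = ∅ := by grind
    simp [levelGain, hempty]

lemma IsLevelwiseBase.sum_mul_le (hx : IsLevelwiseBase f v x) (hv : ∀ i, 0 ≤ v i) (S : Finset E) :
    ∑ i ∈ S, v i * x i ≤ levelRank f v S := by
  rw [sum_mul_eq_sum_levels]
  refine sum_le_sum fun t ht => ?_
  obtain ⟨j, -, rfl⟩ := mem_image.1 ht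
  exact mul_le_mul_of_nonneg_left (hx.sum_le j S) (hv j)

lemma IsLevelwiseBase.sum_mul_eq (hx : IsLevelwiseBase f v x) :
    ∑ i, v i * x i = levelRank f v univ := by
  rw [sum_mul_eq_sum_levels]
  refine sum_congr rfl fun t ht => ?_
  obtain ⟨j, -, rfl⟩ := mem_image.1 ht
  rw [hx.sum_eq]

lemma mem_welfareOptimal_iff_isLevelwiseBase (hf : IsPolymatroidRank f) (hv : ∀ i, 0 < v i) :
    x ∈ welfareOptimal f v ↔ IsLevelwiseBase f v x := by
  obtain ⟨y, hy, hy_tight⟩ := hf.exists_tightOnLevels v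
  have hy_max : ∀ z ∈ indepPolytope f, ∑ i, v i * z i ≤ ∑ i, v i * y i := fun z hz => by
    simpa only [sub_zero] using hy_tight.sum_sub_mul_le hz hv
  constructor
  · rintro ⟨hx, hx_max⟩
    have hx_tight : TightOnLevels f v x :=
      hy_tight.of_sum_sub_mul_le hx hv (by simpa only [sub_zero] using hx_max y hy.1)
    exact hx_tight.isLevelwiseBase hf.empty hx
  · intro hx
    have hxy : ∑ i, v i * x i = ∑ i, v i * y i := by
      rw [hx.sum_mul_eq, (hy_tight.isLevelwiseBase hf.empty hy.1).sum_mul_eq]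
    exact ⟨hx.mem_indepPolytope hf, fun z hz => hxy ▸ hy_max z hz⟩

lemma isLevelwiseBase_of_mul_mem_basePolytope (hv : ∀ i, 0 < v i)
    (hx : (fun i => v i * x i) ∈ basePolytope (levelRank f v)) : IsLevelwiseBase f v x := by
  have hle : ∀ j S, ∑ i ∈ S with v i = v j, x i ≤ levelGain f v (v j) S := fun j S => by
    refine le_of_mul_le_mul_left ?_ (hv j)
    rw [← levelRank_level, mul_sum]
    refine le_of_eq_of_le (sum_congr rfl fun i hi => ?_) (hx.1.2 _)
    rw [← (mem_filter.1 hi).2]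
  refine ⟨fun i => nonneg_of_mul_nonneg_right (hx.1.1 i) (hv i), hle, fun j => ?_⟩
  have hterm_le : ∀ t ∈ univ.image v,
      t * ∑ i with v i = t, x i ≤ t * levelGain f v t univ := fun t ht => by
    obtain ⟨j, -, rfl⟩ := mem_image.1 ht
    exact mul_le_mul_of_nonneg_left (hle j univ) (hv j).le
  have hsum := hx.2
  rw [sum_mul_eq_sum_levels, levelRank, sum_eq_sum_iff_of_le hterm_le] at hsum
  exact mul_left_cancel₀ (hv j).ne' (hsum _ (mem_image_of_mem v (mem_univ j)))

lemma mul_mem_basePolytope_levelRank_iff (hf : IsPolymatroidRank f) (hv : ∀ i, 0 < v i) :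
    (fun i => v i * x i) ∈ basePolytope (levelRank f v) ↔ x ∈ welfareOptimal f v := by
  rw [mem_welfareOptimal_iff_isLevelwiseBase hf hv]
  exact ⟨isLevelwiseBase_of_mul_mem_basePolytope hv, fun hx =>
    ⟨⟨fun i => mul_nonneg (hv i).le (hx.nonneg i), hx.sum_mul_le fun i => (hv i).le⟩,
      hx.sum_mul_eq⟩⟩

lemma isGreatest_levelRank (hf : IsPolymatroidRank f) (hv : ∀ i, 0 < v i) (S : Finset E) :
    IsGreatest (groupUtilities f v S) (levelRank f v S) := by
  refine ⟨?_, ?_⟩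
  · obtain ⟨y, hy, hyS⟩ :=
      (isPolymatroidRank_levelRank hf fun i => (hv i).le).exists_mem_basePolytope_sum_eq S
    have hvy : (fun i => v i * (y i / v i)) = y := funext fun i => mul_div_cancel₀ _ (hv i).ne'
    rw [← hvy] at hy hyS
    exact ⟨_, (mul_mem_basePolytope_levelRank_iff hf hv).1 hy, hyS⟩
  · rintro _ ⟨x, hx, rfl⟩
    exact ((mul_mem_basePolytope_levelRank_iff hf hv).2 hx).1.2 S

lemma saturation_eq_levelRank (hf : IsPolymatroidRank f) (hv : ∀ i, 0 < v i) :
    saturation f v = levelRank f v :=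
  funext fun S => (isGreatest_levelRank hf hv S).csSup_eq

lemma isPolymatroidRank_saturation (hf : IsPolymatroidRank f) (hv : ∀ i, 0 < v i) :
    IsPolymatroidRank (saturation f v) :=
  saturation_eq_levelRank hf hv ▸ isPolymatroidRank_levelRank hf fun i => (hv i).le

end LevelRank

/-! ### Majorized points of base polytopes -/

section SumSmallest

lemma sum_take_add_sum_posPart {G : Type*} [AddCommGroup G] [LinearOrder G] [IsOrderedAddMonoid G]
    {l : List G} {k : ℕ} (hk : k ≤ l.length) (c : G) :
    (l.take k).sum + (l.map fun x => (c - x)⁺).sum =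
      k • c +
        (((l.take k).map fun x => (c - x)⁻).sum + ((l.drop k).map fun x => (c - x)⁺).sum) := by
  have hsplit : (l.map fun x => (c - x)⁺).sum =
      ((l.take k).map fun x => (c - x)⁺).sum + ((l.drop k).map fun x => (c - x)⁺).sum := by
    rw [← List.sum_append, ← List.map_append, List.take_append_drop]
  have hpoint : ∀ x, x + (c - x)⁺ = c + (c - x)⁻ := fun x => by
    rw [add_comm]
    exact sub_eq_sub_iff_add_eq_add.1 (posPart_sub_negPart (c - x))
  have htake : (l.take k).sum + ((l.take k).map fun x => (c - x)⁺).sum =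
      k • c + ((l.take k).map fun x => (c - x)⁻).sum := by
    have hsum := congrArg (fun φ => ((l.take k).map φ).sum) (funext hpoint)
    simpa only [List.sum_map_add, List.map_id', List.map_const', List.sum_replicate,
      List.length_take, min_eq_left hk] using hsum
  rw [hsplit, ← add_assoc, htake, add_assoc]

variable {E : Type*} [Fintype E] {u w : E → ℝ} {k : ℕ}

lemma sum_map_sort_eq_sum (u : E → ℝ) (φ : ℝ → ℝ) :
    (((univ.val.map u).sort (· ≤ ·)).map φ).sum = ∑ i, φ (u i) := by
  rw [← Multiset.sum_coe, ← Multiset.map_coe, Multiset.sort_eq, Multiset.map_map]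
  rfl

lemma nsmul_le_sumSmallest_add_sum_posPart (hk : k ≤ Fintype.card E) (u : E → ℝ) (c : ℝ) :
    k • c ≤ sumSmallest k u + ∑ i, (c - u i)⁺ := by
  rw [← sum_map_sort_eq_sum u fun x => (c - x)⁺, sumSmallest,
    sum_take_add_sum_posPart (by simpa using hk)]
  refine le_add_of_nonneg_right (add_nonneg (List.sum_nonneg ?_) (List.sum_nonneg ?_))
  · simp only [List.forall_mem_map, negPart_nonneg, implies_true]
  · simp only [List.forall_mem_map, posPart_nonneg, implies_true]

lemma exists_sumSmallest_add_sum_posPart_eq (hk : 1 ≤ k) (hkE : k ≤ Fintype.card E) (u : E → ℝ) :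
    ∃ c, sumSmallest k u + ∑ i, (c - u i)⁺ = k • c := by
  set l := (univ.val.map u).sort (· ≤ ·) with hl
  have hkl : k ≤ l.length := by simpa [hl] using hkE
  have hsorted : (l.take k ++ l.drop k).Pairwise (· ≤ ·) := by
    rw [List.take_append_drop]
    exact Multiset.pairwise_sort _ _
  have hne : (l.take k).toFinset.Nonempty := by
    rw [List.toFinset_nonempty_iff, ← List.length_pos_iff, List.length_take]
    omega
  obtain ⟨c, hc, hc_max⟩ := exists_max_image _ id hne
  have htake : ∀ x ∈ l.take k, (c - x)⁻ = 0 := fun x hx =>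
    negPart_eq_zero.2 (sub_nonneg.2 (hc_max x (List.mem_toFinset.2 hx)))
  have hdrop : ∀ x ∈ l.drop k, (c - x)⁺ = 0 := fun x hx =>
    posPart_eq_zero.2 (sub_nonpos.2
      ((List.pairwise_append.1 hsorted).2.2 c (List.mem_toFinset.1 hc) x hx))
  refine ⟨c, ?_⟩
  rw [← sum_map_sort_eq_sum u fun x => (c - x)⁺, sumSmallest, ← hl, sum_take_add_sum_posPart hkl,
    List.map_congr_left htake, List.map_congr_left hdrop]
  simp

lemma sumSmallest_le_sumSmallest (hk : 1 ≤ k) (hkE : k ≤ Fintype.card E)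
    (h : ∀ c, ∑ i, (c - u i)⁺ ≤ ∑ i, (c - w i)⁺) : sumSmallest k w ≤ sumSmallest k u := by
  obtain ⟨c, hc⟩ := exists_sumSmallest_add_sum_posPart_eq hk hkE w
  have hu := nsmul_le_sumSmallest_add_sum_posPart hkE u c
  linarith [h c]

end SumSmallest

section Majorized

variable {E : Type*} [Fintype E]

lemma exists_forall_sum_mul_self_le {K : Set (E → ℝ)} (hK : Convex ℝ K) (hK_closed : IsClosed K)
    (hne : K.Nonempty) : ∃ u ∈ K, ∀ w ∈ K, ∑ i, u i * u i ≤ ∑ i, u i * w i := by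
  let K' : Set (EuclideanSpace ℝ E) := WithLp.ofLp ⁻¹' K
  have hK'_convex : Convex ℝ K' := hK.linear_preimage (WithLp.linearEquiv 2 ℝ (E → ℝ)).toLinearMap
  have hK'_complete : IsComplete K' :=
    (hK_closed.preimage (PiLp.continuous_ofLp 2 fun _ : E => ℝ)).isComplete
  have hK'_ne : K'.Nonempty := hne.preimage (WithLp.ofLp_surjective 2)
  obtain ⟨u, hu, hu_min⟩ := exists_norm_eq_iInf_of_complete_convex hK'_ne hK'_complete hK'_convex 0
  rw [norm_eq_iInf_iff_real_inner_le_zero hK'_convex hu] at hu_min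
  refine ⟨u.ofLp, hu, fun w hw => ?_⟩
  have hinner := hu_min (WithLp.toLp 2 w) hw
  rw [zero_sub, inner_neg_left, inner_sub_right, neg_nonpos, sub_nonneg] at hinner
  simpa only [PiLp.inner_apply, RCLike.inner_apply, conj_trivial, mul_comm] using hinner

lemma IsPolymatroidRank.exists_isMajorized_basePolytope [DecidableEq E] {F : Finset E → ℝ}
    (hF : IsPolymatroidRank F) : ∃ u, IsMajorized 1 (basePolytope F) u := by
  obtain ⟨x, hx, -⟩ := hF.exists_tightOnLevels 0
  obtain ⟨u, hu, hu_min⟩ := exists_forall_sum_mul_self_le (convex_basePolytope F)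
    (isCompact_basePolytope F).isClosed ⟨x, hx⟩
  have hu_tight : TightOnLevels F (fun i => -u i) u := hF.tightOnLevels_of_isMaxOn hu fun y hy => by
    simpa only [neg_mul, sum_neg_distrib, neg_le_neg_iff] using hu_min y hy
  refine ⟨u, hu, fun k hk hkE w hw => ?_⟩
  rw [div_one, one_mul]
  refine sumSmallest_le_sumSmallest hk hkE fun c => ?_
  have hlower : ∑ i with u i ≤ c, w i ≤ ∑ i with u i ≤ c, u i := by
    have htight := hu_tight (-c)
    simp only [neg_le_neg_iff] at htight
    exact htight ▸ hw.1.2 _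
  calc ∑ i, (c - u i)⁺ = ∑ i with u i ≤ c, (c - u i) := by
        rw [sum_filter]
        refine sum_congr rfl fun i _ => ?_
        split_ifs with hi
        · exact posPart_eq_self.2 (sub_nonneg.2 hi)
        · exact posPart_eq_zero.2 (sub_nonpos.2 (not_le.1 hi).le)
    _ ≤ ∑ i with u i ≤ c, (c - w i) := by
        rw [sum_sub_distrib, sum_sub_distrib]
        exact sub_le_sub_left hlower _
    _ ≤ ∑ i with u i ≤ c, (c - w i)⁺ := sum_le_sum fun i _ => le_posPart _
    _ ≤ ∑ i, (c - w i)⁺ :=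
        sum_le_sum_of_subset_of_nonneg (subset_univ _) fun i _ _ => posPart_nonneg _

end Majorized

/-! ### Full revelation -/

section FullRevelation

variable {E : Type*} {vals : Finset ℝ}

lemma signalProb_fullRevelation (D : E → PMF vals) (i : E) (s : vals) :
    signalProb D (fullRevelation E vals) i s = (D i s).toReal := by
  rw [signalProb, sum_eq_single_of_mem s (mem_univ s) fun a _ ha => by simp [ha.symm]]
  simp

lemma posteriorMean_fullRevelation (D : E → PMF vals) (i : E) {s : vals}
    (hs : (D i s).toReal ≠ 0) : posteriorMean D (fullRevelation E vals) i s = s := by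
  rw [posteriorMean, signalProb_fullRevelation,
    sum_eq_single_of_mem s (mem_univ s) fun a _ ha => by simp [ha.symm]]
  simpa using mul_div_cancel_left₀ (s : ℝ) hs

variable [Fintype E] {f : Finset E → ℝ}

/-- The probability that the value vector, and hence the signal profile under full revelation, is
`a`. -/
def valueProb (D : E → PMF vals) (a : E → vals) : ℝ :=
  ∏ i, (D i (a i)).toReal

lemma valueProb_nonneg (D : E → PMF vals) (a : E → vals) : 0 ≤ valueProb D a :=
  prod_nonneg fun _ _ => ENNReal.toReal_nonneg

lemma profileProb_fullRevelation (D : E → PMF vals) (a : E → vals) :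
    profileProb D (fullRevelation E vals) a = valueProb D a :=
  prod_congr rfl fun i _ => signalProb_fullRevelation D i (a i)

lemma posteriorMean_of_valueProb_ne_zero {D : E → PMF vals} {a : E → vals}
    (ha : valueProb D a ≠ 0) (i : E) : posteriorMean D (fullRevelation E vals) i (a i) = a i :=
  posteriorMean_fullRevelation D i (prod_ne_zero_iff.1 ha i (mem_univ i))

lemma isSelectionRule_fullRevelation_iff {D : E → PMF vals} {x : (E → vals) → E → ℝ} :
    IsSelectionRule f D (fullRevelation E vals) x ↔ ∀ a : E → vals, x a ∈ indepPolytope f ∧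
      (0 < valueProb D a → x a ∈ welfareOptimal f fun i => (a i : ℝ)) := by
  refine forall_congr' fun a => and_congr_right' ?_
  rw [profileProb_fullRevelation]
  refine forall_congr' fun ha => ?_
  simp only [posteriorMean_of_valueProb_ne_zero ha.ne']

/-- The policy that always uses the same selection rule. -/
def Policy.dirac {D : E → PMF vals} {M : MappingRule E vals} (x : (∀ i, M.Signal i) → E → ℝ)
    (hx : IsSelectionRule f D M x) : Policy f D M where
  law := Measure.dirac x
  isProbability := Measure.dirac.isProbabilityMeasure
  isSelectionRule := by rwa [ae_dirac_eq]

variable [DecidableEq E]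

/-- The expected utility vector of the full-revelation policy that always uses the selection rule
`x`. -/
def revealedUtility (D : E → PMF vals) (x : (E → vals) → E → ℝ) : E → ℝ :=
  ∑ a, valueProb D a • fun i => (a i : ℝ) * x a i

lemma measurable_revealedUtility (D : E → PMF vals) : Measurable (revealedUtility D) := by
  unfold revealedUtility
  fun_prop

lemma Policy.utility_fullRevelation {D : E → PMF vals} (Ω : Policy f D (fullRevelation E vals))
    (i : E) : Ω.utility i = ∫ x, revealedUtility D x i ∂Ω.law := by
  refine integral_congr_ae (Filter.Eventually.of_forall fun x => ?_)
  simp only [revealedUtility, Finset.sum_apply, Pi.smul_apply, smul_eq_mul]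
  refine sum_congr rfl fun a _ => ?_
  rw [profileProb_fullRevelation]
  obtain ha | ha := eq_or_ne (valueProb D a) 0
  · rw [ha, zero_mul, zero_mul]
  · rw [posteriorMean_of_valueProb_ne_zero ha]

lemma Policy.utility_dirac {D : E → PMF vals} {x : (E → vals) → E → ℝ}
    (hx : IsSelectionRule f D (fullRevelation E vals) x) :
    (Policy.dirac (M := fullRevelation E vals) x hx).utility = revealedUtility D x := by
  funext i
  rw [Policy.utility_fullRevelation]
  exact integral_dirac' _ _
    ((measurable_pi_iff.1 (measurable_revealedUtility D)) i).stronglyMeasurable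

lemma isPolymatroidRank_expectedSaturation (hf : IsPolymatroidRank f) (hvals : ∀ v ∈ vals, 0 < v)
    (D : E → PMF vals) : IsPolymatroidRank (expectedSaturation f D) :=
  isPolymatroidRank_sum_mul (fun a _ => valueProb_nonneg D a) fun a _ =>
    isPolymatroidRank_saturation hf fun i => hvals _ (a i).2

lemma revealedUtility_mem_basePolytope (hf : IsPolymatroidRank f) (hvals : ∀ v ∈ vals, 0 < v)
    {D : E → PMF vals} {x : (E → vals) → E → ℝ}
    (hx : IsSelectionRule f D (fullRevelation E vals) x) :
    revealedUtility D x ∈ basePolytope (expectedSaturation f D) := by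
  refine sum_smul_mem_basePolytope (valueProb_nonneg D) fun a ha => ?_
  have hpos : ∀ i, 0 < (a i : ℝ) := fun i => hvals _ (a i).2
  rw [saturation_eq_levelRank hf hpos, mul_mem_basePolytope_levelRank_iff hf hpos]
  exact (isSelectionRule_fullRevelation_iff.1 hx a).2 ha

lemma Policy.utility_mem_basePolytope (hf : IsPolymatroidRank f) (hvals : ∀ v ∈ vals, 0 < v)
    {D : E → PMF vals} (Ω : Policy f D (fullRevelation E vals)) :
    Ω.utility ∈ basePolytope (expectedSaturation f D) := by
  have := Ω.isProbability
  have hmem : ∀ᵐ x ∂Ω.law, revealedUtility D x ∈ basePolytope (expectedSaturation f D) :=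
    Ω.isSelectionRule.mono fun x hx => revealedUtility_mem_basePolytope hf hvals hx
  obtain ⟨C, hC⟩ := (isCompact_basePolytope (expectedSaturation f D)).isBounded.exists_norm_le
  have hint : Integrable (revealedUtility D) Ω.law :=
    .of_bound (measurable_revealedUtility D).aestronglyMeasurable C (hmem.mono fun x hx => hC _ hx)
  have hutility : Ω.utility = ∫ x, revealedUtility D x ∂Ω.law := funext fun i => by
    rw [Ω.utility_fullRevelation, eval_integral fun i => hint.eval i]
  rw [hutility]
  exact (convex_basePolytope _).integral_mem (isCompact_basePolytope _).isClosed hmem hint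

lemma exists_revealedUtility_eq (hf : IsPolymatroidRank f) (hvals : ∀ v ∈ vals, 0 < v)
    {D : E → PMF vals} {z : E → ℝ} (hz : z ∈ basePolytope (expectedSaturation f D)) :
    ∃ x, IsSelectionRule f D (fullRevelation E vals) x ∧ revealedUtility D x = z := by
  have hpos : ∀ (a : E → vals) i, 0 < (a i : ℝ) := fun a i => hvals _ (a i).2
  obtain ⟨y, hy, rfl⟩ := exists_sum_smul_eq_of_mem_basePolytope
    (fun a => isPolymatroidRank_saturation hf (hpos a)) hz
  have hscale : ∀ a, (fun i => (a i : ℝ) * (y a i / a i)) = y a := fun a =>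
    funext fun i => mul_div_cancel₀ _ (hpos a i).ne'
  have hopt : ∀ a, (fun i => y a i / a i) ∈ welfareOptimal f fun i => (a i : ℝ) := fun a => by
    rw [← mul_mem_basePolytope_levelRank_iff hf (hpos a), hscale,
      ← saturation_eq_levelRank hf (hpos a)]
    exact hy a
  refine ⟨fun a i => y a i / a i,
    isSelectionRule_fullRevelation_iff.2 fun a => ⟨(hopt a).1, fun _ => hopt a⟩, ?_⟩
  simp only [revealedUtility, hscale, valueProb]

lemma fullRevelationUtilities_eq_basePolytope (hf : IsPolymatroidRank f)
    (hvals : ∀ v ∈ vals, 0 < v) (D : E → PMF vals) :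
    fullRevelationUtilities f D = basePolytope (expectedSaturation f D) := by
  refine Set.Subset.antisymm ?_ fun z hz => ?_
  · rintro _ ⟨Ω, rfl⟩
    exact Ω.utility_mem_basePolytope hf hvals
  · obtain ⟨x, hx, rfl⟩ := exists_revealedUtility_eq hf hvals hz
    exact ⟨Policy.dirac x hx, Policy.utility_dirac hx⟩

end FullRevelation

end Persuasion

end

theorem mainTheorem3 {E : Type*} [Fintype E] [DecidableEq E]
    (f : Finset E → ℝ) (hf : Persuasion.IsPolymatroidRank f)
    (vals : Finset ℝ) (hvals : ∀ v ∈ vals, 0 < v) (D : E → PMF vals) :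
    (∃ u, Persuasion.IsMajorized 1 (Persuasion.fullRevelationUtilities f D) u) ∧
    Persuasion.IsPolymatroidRank (Persuasion.expectedSaturation f D) ∧
    Persuasion.fullRevelationUtilities f D =
      Persuasion.basePolytope (Persuasion.expectedSaturation f D) ∧
    (∀ (a : E → vals) (S : Finset E),
      IsGreatest (Persuasion.groupUtilities f (fun i => (a i : ℝ)) S)
        (Persuasion.saturation f (fun i => (a i : ℝ)) S)) := by
  have hF := Persuasion.isPolymatroidRank_expectedSaturation hf hvals D
  have hU := Persuasion.fullRevelationUtilities_eq_basePolytope hf hvals D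
  refine ⟨hU ▸ hF.exists_isMajorized_basePolytope, hF, hU, fun a S => ?_⟩
  have ha : ∀ i, 0 < (a i : ℝ) := fun i => hvals _ (a i).2
  rw [Persuasion.saturation_eq_levelRank hf ha]
  exact Persuasion.isGreatest_levelRank hf ha S
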